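/- **Conventions.** A many-sorted signature $\Sigma$ consists of countable sets of sorts, of function symbols and of predicate symbols, each symbol having an arity; every sort $\sigma$ has its own equality symbol (interpreted as identity) and its own countably infinite set of variables. Terms and first-order formulas are defined as usual; $\mathit{vars}(\varphi)$ and $\mathit{vars}_\sigma(\varphi)$ denote the sets of free variables, and of free variables of sort $\sigma$, of $\varphi$. A $\Sigma$-interpretation $\mathcal A$ is a $\Sigma$-structure with (nonempty) domains $\sigma^{\mathcal A}$ together with a value $x^{\mathcal A}$ in the appropriate domain for each variable $x$. A $\Sigma$-theory $\mathcal T$ is the class of all $\Sigma$-structures satisfying some set of closed formulas; a $\mathcal T$-interpretation is an interpretation whose underlying structure lies in $\mathcal T$. A formula is $\mathcal T$-satisfiable if some $\mathcal T$-interpretation satisfies it; two formulas are $\mathcal T$-equivalent if they are satisfied by the same $\mathcal T$-interpretations. Let $S$ be a set of sorts of $\Sigma$. - $\mathcal T$ is *stably infinite* w.r.t. $S$ if every $\mathcal T$-satisfiable quantifier-free formula is satisfied by a $\mathcal T$-interpretation $\mathcal A$ such that $\sigma^{\mathcal A}$ is infinite for every $\sigma\in S$. - For finite sets $V_\sigma$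 of variables of sort $\sigma$ ($\sigma\in S$) with finite union $V$, and equivalence relations $E_\sigma$ on $V_\sigma$, the *arrangement* $\delta_V$ is the conjunction, over all $\sigma\in S$ and $x,y\in V_\sigma$, of $x=y$ if $xE_\sigma y$ and of $\neg(x=y)$ otherwise. - $\mathcal T$ is *strongly finitely witnessable* w.r.t. $S$ if there is a computable function $\mathit{wit}$ (with respect to a Gödel numbering of formulas induced by some numbering of the symbols of $\Sigma$) from quantifier-free formulas to quantifier-free formulas such that, for every quantifier-free $\phi$: (i) $\phi$ and $\exists\,\vec w.\,\mathit{wit}(\phi)$ are $\mathcal T$-equivalent, where $\vec w=\mathit{vars}(\mathit{wit}(\phi))\setminus \mathit{vars}(\phi)$; and (ii) for every finite set $V$ of variables with sorts in $S$ and every arrangement $\delta_V$ on $V$, if $\mathit{wit}(\phi)\wedge\delta_V$ is $\mathcal T$-satisfiable, then it is satisfied by a $\mathcal T$-interpretation $\mathcal A$ such that $\sigma^{\mathcal A}=\{x^{\mathcal A} : x\in \mathit{vars}_\sigma(\mathit{wit}(\phi)\wedge\delta_V)\}$ for every $\sigma\in S$. **Lemma.** Let $\mathcal T$ be a $\Sigma$-theory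 that is stably infinite and strongly finitely witnessable, both w.r.t. the set of sorts $S$. Let $\phi$ be a quantifier-free $\Sigma$-formula, let $\mathcal A$ be a $\mathcal T$-interpretation that satisfies $\phi$, put $S_\omega^{\mathcal A}=\{\sigma\in S : |\sigma^{\mathcal A}|\le\omega\}$, and let $\kappa$ be a function from $S_\omega^{\mathcal A}$ to the class of cardinals with $|\sigma^{\mathcal A}|\le\kappa(\sigma)\le\omega$ for every $\sigma\in S_\omega^{\mathcal A}$. Then there is a $\mathcal T$-interpretation $\mathcal B$ that satisfies $\phi$ such that $|\sigma^{\mathcal B}|=\kappa(\sigma)$ for every $\sigma\in S_\omega^{\mathcal A}$ and $|\sigma^{\mathcal B}|=\omega$ for every $\sigma\in S\setminus S_\omega^{\mathcal A}$. -/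

import Mathlib

universe u v

namespace ManySorted

/-- A many-sorted signature: countable sets of sorts, function symbols and predicate symbols, each
symbol having an arity. The equality symbol of each sort is built into the syntax of formulas and is
therefore not listed among the `PredSym`. -/
structure Signature where
  Srt : Type v
  FunSym : Type v
  PredSym : Type v
  countable_srt : Countable Srt
  countable_funSym : Countable FunSym
  countable_predSym : Countable PredSym
  /-- argument sorts of a function symbol -/
  dom : FunSym → List Srt
  /-- value sort of a function symbol -/
  cod : FunSym → Srt
  /-- argument sorts of a predicate symbol -/
  predDom : PredSym → List Srt

/-- The variables: for each sort `σ`, the countably many variables `(σ, 0), (σ, 1), …`. -/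
abbrev Var (Sg : Signature.{v}) : Type v := Sg.Srt × ℕ

/-- Terms, indexed by their sort. -/
inductive Term (Sg : Signature.{v}) : Sg.Srt → Type v
  | var (σ : Sg.Srt) (n : ℕ) : Term Sg σ
  | app (f : Sg.FunSym) (args : ∀ i : Fin (Sg.dom f).length, Term Sg ((Sg.dom f).get i)) :
      Term Sg (Sg.cod f)

/-- First-order formulas with (named) sorted variables. -/
inductive Formula (Sg : Signature.{v}) : Type v
  | falsum : Formula Sg
  | eq {σ : Sg.Srt} (s t : Term Sg σ) : Formula Sg
  | rel (p : Sg.PredSym)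
      (args : ∀ i : Fin (Sg.predDom p).length, Term Sg ((Sg.predDom p).get i)) : Formula Sg
  | neg (φ : Formula Sg) : Formula Sg
  | and (φ ψ : Formula Sg) : Formula Sg
  | or (φ ψ : Formula Sg) : Formula Sg
  | imp (φ ψ : Formula Sg) : Formula Sg
  | all (x : Var Sg) (φ : Formula Sg) : Formula Sg
  | ex (x : Var Sg) (φ : Formula Sg) : Formula Sg

variable {Sg : Signature.{v}}

open Classical in
/-- The variables of a term. -/
noncomputable def Term.vars : {σ : Sg.Srt} → Term Sg σ → Finset (Var Sg)
  | _, .var σ n => {(σ, n)}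
  | _, .app _ args => Finset.univ.biUnion fun i => (args i).vars

open Classical in
/-- The free variables of a formula. -/
noncomputable def Formula.vars : Formula Sg → Finset (Var Sg)
  | .falsum => ∅
  | .eq s t => s.vars ∪ t.vars
  | .rel _ args => Finset.univ.biUnion fun i => (args i).vars
  | .neg φ => φ.vars
  | .and φ ψ => φ.vars ∪ ψ.vars
  | .or φ ψ => φ.vars ∪ ψ.vars
  | .imp φ ψ => φ.vars ∪ ψ.vars
  | .all x φ => φ.vars.erase x
  | .ex x φ => φ.vars.erase x

/-- The free variables of sort `σ` of a formula. -/
def Formula.varsOfSort (φ : Formula Sg) (σ : Sg.Srt) : Set (Var Sg) :=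
  {x | x ∈ φ.vars ∧ x.1 = σ}

/-- Quantifier-free formulas. -/
def Formula.IsQF : Formula Sg → Prop
  | .falsum => True
  | .eq _ _ => True
  | .rel _ _ => True
  | .neg φ => φ.IsQF
  | .and φ ψ => φ.IsQF ∧ ψ.IsQF
  | .or φ ψ => φ.IsQF ∧ ψ.IsQF
  | .imp φ ψ => φ.IsQF ∧ ψ.IsQF
  | .all _ _ => False
  | .ex _ _ => False

/-- The type of quantifier-free formulas. -/
abbrev QFFormula (Sg : Signature.{v}) : Type v := {φ : Formula Sg // φ.IsQF}

/-- Finite conjunction; the empty conjunction is `¬ ⊥`. -/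
def Formula.conj : List (Formula Sg) → Formula Sg
  | [] => .neg .falsum
  | φ :: l => .and φ (Formula.conj l)

/-- `∃ x₁. ⋯ ∃ xₙ. φ`. -/
def Formula.exs (l : List (Var Sg)) (φ : Formula Sg) : Formula Sg :=
  l.foldr .ex φ

/-- `∃ w. ψ` where `w` lists the free variables of `ψ` that are not free in `φ`. -/
noncomputable def Formula.exExtra (φ ψ : Formula Sg) : Formula Sg :=
  open Classical in Formula.exs (ψ.vars \ φ.vars).toList ψ

/-- A structure over the signature: (nonempty) domains, functions and predicates. -/
structure Struct (Sg : Signature.{v}) where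
  carrier : Sg.Srt → Type u
  nonempty : ∀ σ, Nonempty (carrier σ)
  funI : ∀ f : Sg.FunSym,
    (∀ i : Fin (Sg.dom f).length, carrier ((Sg.dom f).get i)) → carrier (Sg.cod f)
  predI : ∀ p : Sg.PredSym,
    (∀ i : Fin (Sg.predDom p).length, carrier ((Sg.predDom p).get i)) → Prop

/-- An assignment of elements of the right domains to all variables. -/
abbrev Struct.Valuation (M : Struct.{u, v} Sg) : Type (max u v) := ∀ x : Var Sg, M.carrier x.1

/-- Value of a term. -/
def Term.eval (M : Struct.{u, v} Sg) (val : M.Valuation) :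
    {σ : Sg.Srt} → Term Sg σ → M.carrier σ
  | _, .var σ n => val (σ, n)
  | _, .app f args => M.funI f fun i => (args i).eval M val

open Classical in
/-- Satisfaction (Tarski semantics), equality being interpreted as identity. -/
def Formula.Sat (M : Struct.{u, v} Sg) : M.Valuation → Formula Sg → Prop
  | _, .falsum => False
  | val, .eq s t => s.eval M val = t.eval M val
  | val, .rel p args => M.predI p fun i => (args i).eval M val
  | val, .neg φ => ¬ φ.Sat M val
  | val, .and φ ψ => φ.Sat M val ∧ ψ.Sat M val
  | val, .or φ ψ => φ.Sat M val ∨ ψ.Sat M val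
  | val, .imp φ ψ => φ.Sat M val → ψ.Sat M val
  | val, .all x φ => ∀ a : M.carrier x.1, φ.Sat M (Function.update val x a)
  | val, .ex x φ => ∃ a : M.carrier x.1, φ.Sat M (Function.update val x a)

/-- An interpretation: a structure together with values for all variables. -/
structure Interp (Sg : Signature.{v}) extends Struct.{u, v} Sg where
  val : toStruct.Valuation

/-- `A ⊨ φ`. -/
def Interp.Satisfies (A : Interp.{u, v} Sg) (φ : Formula Sg) : Prop :=
  φ.Sat A.toStruct A.val

/-- A theory, given by an axiomatization, i.e. a set of closed formulas. -/
structure Theory (Sg : Signature.{v}) where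
  Ax : Set (Formula Sg)
  closed : ∀ φ ∈ Ax, φ.vars = ∅

/-- The class of models of a theory. -/
def Theory.models (T : Theory Sg) : Set (Struct.{u, v} Sg) :=
  {M | ∀ φ ∈ T.Ax, ∀ val : M.Valuation, φ.Sat M val}

/-- `A` is a `T`-interpretation. -/
def Theory.IsInterp (T : Theory Sg) (A : Interp.{u, v} Sg) : Prop :=
  A.toStruct ∈ T.models

/-- `φ` is `T`-satisfiable (in a structure with domains in the universe `u`). -/
def Theory.Satisfiable (T : Theory Sg) (φ : Formula Sg) : Prop :=
  ∃ A : Interp.{u, v} Sg, T.IsInterp A ∧ A.Satisfies φ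

/-- `φ` and `ψ` are `T`-equivalent. -/
def Theory.Equivalent (T : Theory Sg) (φ ψ : Formula Sg) : Prop :=
  ∀ A : Interp.{u, v} Sg, T.IsInterp A → (A.Satisfies φ ↔ A.Satisfies ψ)

/-- `T` is stably infinite with respect to `S`. -/
def Theory.StablyInfinite (T : Theory Sg) (S : Set Sg.Srt) : Prop :=
  ∀ φ : QFFormula Sg, Theory.Satisfiable.{u, v} T φ.1 →
    ∃ A : Interp.{u, v} Sg, T.IsInterp A ∧ A.Satisfies φ.1 ∧ ∀ σ ∈ S, Infinite (A.carrier σ)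

open Classical in
/-- The arrangement `δ_V` on the finite set of variables `V` induced by equivalence relations on the
sets `V_σ` of the variables of sort `σ` in `V`: the conjunction, over all pairs of variables of the
same sort in `V`, of `x = y` if `x` and `y` are equivalent and `¬ (x = y)` otherwise. The equivalence
relation on `V_σ` is given as the restriction of an equivalence relation `E σ` on (the indices of)
all variables of sort `σ`. -/
noncomputable def arrangement (V : Finset (Var Sg)) (E : Sg.Srt → Setoid ℕ) : Formula Sg :=
  Formula.conj (V.toList.flatMap fun x =>
    (V.filter fun y => y.1 = x.1).toList.map fun y =>
      if (E x.1) x.2 y.2 then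
        .eq (.var x.1 x.2) (.var x.1 y.2)
      else
        .neg (.eq (.var x.1 x.2) (.var x.1 y.2)))

/-- A numbering of the symbols of a signature. -/
structure Numbering (Sg : Signature.{v}) where
  srt : Sg.Srt → ℕ
  funSym : Sg.FunSym → ℕ
  predSym : Sg.PredSym → ℕ
  srt_injective : Function.Injective srt
  funSym_injective : Function.Injective funSym
  predSym_injective : Function.Injective predSym

/-- Gödel number of a term. -/
def Term.code (c : Numbering Sg) : {σ : Sg.Srt} → Term Sg σ → ℕ
  | _, .var σ n => Encodable.encode ((0 : ℕ), c.srt σ, n)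
  | _, .app f args => Encodable.encode ((1 : ℕ), c.funSym f, List.ofFn fun i => (args i).code c)

/-- Gödel number of a formula. -/
def Formula.code (c : Numbering Sg) : Formula Sg → ℕ
  | .falsum => Encodable.encode ((0 : ℕ), (0 : ℕ), (0 : ℕ))
  | .eq s t => Encodable.encode ((1 : ℕ), s.code c, t.code c)
  | .rel p args => Encodable.encode ((2 : ℕ), c.predSym p, List.ofFn fun i => (args i).code c)
  | .neg φ => Encodable.encode ((3 : ℕ), φ.code c, (0 : ℕ))
  | .and φ ψ => Encodable.encode ((4 : ℕ), φ.code c, ψ.code c)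
  | .or φ ψ => Encodable.encode ((5 : ℕ), φ.code c, ψ.code c)
  | .imp φ ψ => Encodable.encode ((6 : ℕ), φ.code c, ψ.code c)
  | .all x φ => Encodable.encode ((7 : ℕ), Encodable.encode (c.srt x.1, x.2), φ.code c)
  | .ex x φ => Encodable.encode ((8 : ℕ), Encodable.encode (c.srt x.1, x.2), φ.code c)

/-- A function from quantifier-free formulas to quantifier-free formulas is computable if, for some
numbering of the symbols, a partial recursive function maps the Gödel number of each quantifier-free
formula to the Gödel number of its image. -/
def ComputableOnQF (wit : QFFormula Sg → QFFormula Sg) : Prop :=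
  ∃ (c : Numbering Sg) (f : ℕ →. ℕ), Nat.Partrec f ∧
    ∀ φ : QFFormula Sg, (wit φ).1.code c ∈ f (φ.1.code c)

/-- `wit` is a strong witness for `T` with respect to `S`. -/
structure IsStrongWitness (T : Theory Sg) (S : Set Sg.Srt)
    (wit : QFFormula Sg → QFFormula Sg) : Prop where
  computable : ComputableOnQF wit
  equivalent : ∀ φ : QFFormula Sg,
    Theory.Equivalent.{u, v} T φ.1 (Formula.exExtra φ.1 (wit φ).1)
  finite_witness : ∀ (φ : QFFormula Sg) (V : Finset (Var Sg)) (E : Sg.Srt → Setoid ℕ),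
    (∀ x ∈ V, x.1 ∈ S) →
    Theory.Satisfiable.{u, v} T ((wit φ).1.and (arrangement V E)) →
    ∃ A : Interp.{u, v} Sg, T.IsInterp A ∧ A.Satisfies ((wit φ).1.and (arrangement V E)) ∧
      ∀ σ ∈ S, ∀ a : A.carrier σ, ∃ n : ℕ,
        (σ, n) ∈ ((wit φ).1.and (arrangement V E)).varsOfSort σ ∧ A.val (σ, n) = a

/-- `T` is strongly finitely witnessable with respect to `S`. -/
def Theory.StronglyFinitelyWitnessable (T : Theory Sg) (S : Set Sg.Srt) : Prop :=
  ∃ wit : QFFormula Sg → QFFormula Sg, IsStrongWitness.{u, v} T S wit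

/-- The set of the sorts in `S` whose domain in `A` is countable (finite or countably infinite). -/
def countableSorts (S : Set Sg.Srt) (A : Interp.{u, v} Sg) : Set Sg.Srt :=
  {σ | σ ∈ S ∧ Cardinal.mk (A.carrier σ) ≤ Cardinal.aleph0}

end ManySorted

namespace ManySorted

variable {Sg : Signature.{v}}

/-! ### Satisfaction and free variables -/

/-! Suppose first that finite target sizes `N σ` are prescribed on a finite set `F` of sorts from
`S`. A model of `φ` carries a valuation satisfying `wit φ`. Let `V₀` be the variables of `wit φ`
with sorts in `S`, arranged as this valuation dictates. Stable infiniteness gives a model of `wit φ`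
and this arrangement whose `S`-domains are infinite. The arrangement fixes the number of values
taken by `V₀` in each sort: at most the size of the original domain, and at most the number of
variables of `wit φ`. If `N σ` exceeds either bound or equals it, fresh variables can name further
elements until exactly `N σ` values occur. Strong finite witnessability, applied to the enlarged
arrangement, then gives a model in which these values are the whole domain
(`IsStrongWitness.exists_interp_mk_eq`).

Infinite targets, and infinitely many sorts, come from a limit. The `n`-th model has the right
finite sizes, and sizes at least `n` where `ω` is wanted, on the first `n` sorts in an enumeration.
By Łoś's theorem (`Formula.sat_ultraVal`) a nonprincipal ultraproduct is a model of `φ`; it keeps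
the finite sizes and is infinite on the other sorts of `S`. Downward Löwenheim–Skolem
(`Interp.exists_countable_elementary`) cuts the infinite domains to `ω` and preserves finite ones.
-/

theorem Term.eval_congr (M : Struct.{u, v} Sg) {val val' : M.Valuation} {σ : Sg.Srt}
    (t : Term Sg σ) (h : ∀ x ∈ t.vars, val x = val' x) : t.eval M val = t.eval M val' := by
  induction t with
  | var σ n => exact h _ (by simp [Term.vars])
  | app f args ih =>
    simp only [Term.eval]
    congr 1
    funext i
    exact ih i fun x hx => h x (by simpa [Term.vars] using ⟨i, hx⟩)

theorem Formula.sat_congr (M : Struct.{u, v} Sg) (φ : Formula Sg) :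
    ∀ {val val' : M.Valuation}, (∀ x ∈ φ.vars, val x = val' x) →
      (φ.Sat M val ↔ φ.Sat M val') := by
  classical
  induction φ with
  | falsum => intro val val' _; rfl
  | eq s t =>
    intro val val' h
    simp only [Formula.Sat]
    rw [s.eval_congr M fun x hx => h x (by simp [Formula.vars, hx]),
      t.eval_congr M fun x hx => h x (by simp [Formula.vars, hx])]
  | rel p args =>
    intro val val' h
    simp only [Formula.Sat]
    have : (fun i => (args i).eval M val) = fun i => (args i).eval M val' := by
      funext i
      exact (args i).eval_congr M fun x hx => h x (by simpa [Formula.vars] using ⟨i, hx⟩)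
    rw [this]
  | neg φ ih => intro val val' h; exact not_congr (ih h)
  | and φ ψ ih₁ ih₂ =>
    intro val val' h
    exact and_congr (ih₁ fun x hx => h x (by simp [Formula.vars, hx]))
      (ih₂ fun x hx => h x (by simp [Formula.vars, hx]))
  | or φ ψ ih₁ ih₂ =>
    intro val val' h
    exact or_congr (ih₁ fun x hx => h x (by simp [Formula.vars, hx]))
      (ih₂ fun x hx => h x (by simp [Formula.vars, hx]))
  | imp φ ψ ih₁ ih₂ =>
    intro val val' h
    exact imp_congr (ih₁ fun x hx => h x (by simp [Formula.vars, hx]))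
      (ih₂ fun x hx => h x (by simp [Formula.vars, hx]))
  | all x φ ih =>
    intro val val' h
    refine forall_congr' fun a => ih fun y hy => ?_
    rcases eq_or_ne y x with rfl | hne
    · simp
    · simp only [Function.update_of_ne hne]
      exact h y (by simp [Formula.vars, hne, hy])
  | ex x φ ih =>
    intro val val' h
    refine exists_congr fun a => ih fun y hy => ?_
    rcases eq_or_ne y x with rfl | hne
    · simp
    · simp only [Function.update_of_ne hne]
      exact h y (by simp [Formula.vars, hne, hy])

theorem Formula.sat_exs_of_sat (M : Struct.{u, v} Sg) {val : M.Valuation} (l : List (Var Sg))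
    {φ : Formula Sg} (h : φ.Sat M val) : (Formula.exs l φ).Sat M val := by
  classical
  induction l with
  | nil => exact h
  | cons x l ih =>
    change ∃ a, (Formula.exs l φ).Sat M (Function.update val x a)
    exact ⟨val x, by rwa [Function.update_eq_self]⟩

/-- No agreement between `val'` and `val` is recorded: only satisfiability of the matrix in the same
structure is needed, since it bounds the number of values by the size of the domain. -/
theorem Formula.exists_sat_of_sat_exs (M : Struct.{u, v} Sg) (l : List (Var Sg))
    {φ : Formula Sg} : ∀ {val : M.Valuation}, (Formula.exs l φ).Sat M val →
      ∃ val' : M.Valuation, φ.Sat M val' := by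
  induction l with
  | nil => exact fun h => ⟨_, h⟩
  | cons x l ih => exact fun ⟨_, h⟩ => ih h

/-! ### Arrangements -/

theorem Formula.sat_conj (M : Struct.{u, v} Sg) (val : M.Valuation) (l : List (Formula Sg)) :
    (Formula.conj l).Sat M val ↔ ∀ φ ∈ l, φ.Sat M val := by
  induction l with
  | nil => simp [Formula.conj, Formula.Sat]
  | cons φ l ih => simp [Formula.conj, Formula.Sat, ih]

theorem Formula.isQF_conj {l : List (Formula Sg)} (h : ∀ φ ∈ l, φ.IsQF) :
    (Formula.conj l).IsQF := by
  induction l with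
  | nil => trivial
  | cons φ l ih => exact ⟨h _ (by simp), ih fun ψ hψ => h _ (by simp [hψ])⟩

theorem Formula.vars_conj_subset {l : List (Formula Sg)} {V : Finset (Var Sg)}
    (h : ∀ φ ∈ l, φ.vars ⊆ V) : (Formula.conj l).vars ⊆ V := by
  classical
  induction l with
  | nil => simp [Formula.conj, Formula.vars]
  | cons φ l ih =>
    simp only [Formula.conj, Formula.vars]
    exact Finset.union_subset (h _ (by simp)) (ih fun ψ hψ => h _ (by simp [hψ]))

theorem isQF_arrangement (V : Finset (Var Sg)) (E : Sg.Srt → Setoid ℕ) :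
    (arrangement V E).IsQF := by
  refine Formula.isQF_conj fun φ hφ => ?_
  simp only [List.mem_flatMap, List.mem_map] at hφ
  obtain ⟨x, -, y, -, rfl⟩ := hφ
  split_ifs <;> trivial

theorem vars_arrangement_subset (V : Finset (Var Sg)) (E : Sg.Srt → Setoid ℕ) :
    (arrangement V E).vars ⊆ V := by
  classical
  refine Formula.vars_conj_subset fun φ hφ => ?_
  simp only [List.mem_flatMap, List.mem_map, Finset.mem_toList, Finset.mem_filter] at hφ
  obtain ⟨⟨σ, m⟩, hx, ⟨τ, n⟩, ⟨hy, rfl⟩, rfl⟩ := hφ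
  split_ifs <;>
  · simp only [Formula.vars, Term.vars]
    intro z hz
    simp only [Finset.mem_union, Finset.mem_singleton] at hz
    rcases hz with rfl | rfl <;> assumption

theorem sat_arrangement (M : Struct.{u, v} Sg) (val : M.Valuation) (V : Finset (Var Sg))
    (E : Sg.Srt → Setoid ℕ) :
    (arrangement V E).Sat M val ↔ ∀ σ m n, (σ, m) ∈ V → (σ, n) ∈ V →
      (E σ m n ↔ val (σ, m) = val (σ, n)) := by
  classical
  rw [arrangement, Formula.sat_conj]
  simp only [List.mem_flatMap, List.mem_map, Finset.mem_toList, Finset.mem_filter]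
  constructor
  · intro h σ m n hm hn
    have := h _ ⟨(σ, m), hm, (σ, n), ⟨hn, rfl⟩, rfl⟩
    split_ifs at this with hE
    · exact ⟨fun _ => this, fun _ => hE⟩
    · exact ⟨fun h' => absurd h' hE, fun h' => absurd h' this⟩
  · rintro h φ ⟨⟨σ, m⟩, hx, ⟨τ, n⟩, ⟨hy, rfl⟩, rfl⟩
    have := h _ m n hx hy
    split_ifs with hE
    · exact this.1 hE
    · exact fun h' => hE (this.2 h')

/-- The equivalences on variables induced by a valuation. -/
def valKer {M : Struct.{u, v} Sg} (val : M.Valuation) (σ : Sg.Srt) : Setoid ℕ :=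
  Setoid.ker (β := M.carrier σ) fun n => val (σ, n)

theorem sat_arrangement_ker (M : Struct.{u, v} Sg) (val : M.Valuation) (V : Finset (Var Sg)) :
    (arrangement V (valKer val)).Sat M val :=
  (sat_arrangement M val V _).2 fun _ _ _ _ _ => Iff.rfl

/-! ### Countability of the set of formulas -/

theorem Signature.nonempty_numbering (Sg : Signature.{v}) : Nonempty (Numbering Sg) := by
  obtain ⟨f, hf⟩ := Sg.countable_srt.exists_injective_nat
  obtain ⟨g, hg⟩ := Sg.countable_funSym.exists_injective_nat
  obtain ⟨k, hk⟩ := Sg.countable_predSym.exists_injective_nat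
  exact ⟨⟨f, g, k, hf, hg, hk⟩⟩

/-- The two sorts may differ because the codes of an equation and of function arguments do not
display the sorts of the subterms; these must be recovered from the codes. -/
theorem Term.code_injective (c : Numbering Sg) {σ : Sg.Srt} (s : Term Sg σ) :
    ∀ {τ : Sg.Srt} (t : Term Sg τ), s.code c = t.code c →
      (⟨σ, s⟩ : Σ σ, Term Sg σ) = ⟨τ, t⟩ := by
  induction s with
  | var σ n =>
    intro τ t h
    cases t with
    | var τ m =>
      simp only [Term.code, Encodable.encode_inj, Prod.mk.injEq, true_and] at h
      obtain ⟨h, rfl⟩ := h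
      rw [c.srt_injective h]
    | app g args =>
      have := congrArg Nat.unpair h
      simp [Term.code] at this
  | app f args ih =>
    intro τ t h
    cases t with
    | var τ m =>
      have := congrArg Nat.unpair h
      simp [Term.code] at this
    | app g args' =>
      simp only [Term.code, Encodable.encode_inj, Prod.mk.injEq, true_and] at h
      obtain ⟨h, h'⟩ := h
      obtain rfl := c.funSym_injective h
      rw [List.ofFn_inj] at h'
      have : args = args' := by
        funext i
        have := ih i _ (congrFun h' i)
        simpa using this
      rw [this]

theorem Term.code_inj (c : Numbering Sg) {σ : Sg.Srt} {s t : Term Sg σ}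
    (h : s.code c = t.code c) : s = t := by
  simpa using s.code_injective c t h

theorem Formula.code_injective (c : Numbering Sg) :
    Function.Injective (Formula.code c : Formula Sg → ℕ) := by
  intro φ
  induction φ with
  | falsum =>
    intro ψ h
    cases ψ <;> simp [Formula.code] at h ⊢
  | eq s t =>
    intro ψ h
    cases ψ with
    | eq s' t' =>
      simp only [Formula.code, Encodable.encode_inj, Prod.mk.injEq, true_and] at h
      obtain ⟨h₁, h₂⟩ := h
      obtain ⟨rfl, h₁⟩ := Sigma.mk.inj_iff.1 (s.code_injective c _ h₁)
      rw [eq_of_heq h₁, Term.code_inj c h₂]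
    | _ =>
      have := congrArg Nat.unpair h
      simp [Formula.code] at this
  | rel p args =>
    intro ψ h
    cases ψ with
    | rel q args' =>
      simp only [Formula.code, Encodable.encode_inj, Prod.mk.injEq, true_and] at h
      obtain ⟨h, h'⟩ := h
      obtain rfl := c.predSym_injective h
      rw [List.ofFn_inj] at h'
      congr 1
      funext i
      exact Term.code_inj c (congrFun h' i)
    | _ =>
      have := congrArg Nat.unpair h
      simp [Formula.code] at this
  | neg φ ih =>
    intro ψ h
    cases ψ <;> simp [Formula.code] at h ⊢
    exact ih h
  | and φ φ' ih ih' | or φ φ' ih ih' | imp φ φ' ih ih' =>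
    intro ψ h
    cases ψ <;> simp [Formula.code] at h ⊢
    exact ⟨ih h.1, ih' h.2⟩
  | all x φ ih | ex x φ ih =>
    intro ψ h
    cases ψ <;> simp [Formula.code] at h ⊢
    exact ⟨Prod.ext (c.srt_injective h.1.1) h.1.2, ih h.2⟩

/-- Keeps the Skolem hull countable: each closure step adds witnesses indexed by formulas. -/
instance Formula.countable : Countable (Formula Sg) :=
  (Formula.code_injective Sg.nonempty_numbering.some).countable

/-! ### Ultraproducts -/

/-- Equality almost everywhere with respect to an ultrafilter. -/
def ultraSetoid (U : Ultrafilter ℕ) (M : ℕ → Struct.{u, v} Sg) (σ : Sg.Srt) :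
    Setoid (∀ n, (M n).carrier σ) where
  r f g := ∀ᶠ n in U, f n = g n
  iseqv := ⟨fun _ => .of_forall fun _ => rfl, fun h => h.mono fun _ => Eq.symm,
    fun h h' => (h.and h').mono fun _ hn => hn.1.trans hn.2⟩

/-- The ultraproduct of a sequence of structures. -/
noncomputable def ultraproduct (U : Ultrafilter ℕ) (M : ℕ → Struct.{u, v} Sg) :
    Struct.{u, v} Sg where
  carrier σ := Quotient (ultraSetoid U M σ)
  nonempty σ := ⟨Quotient.mk _ fun n => ((M n).nonempty σ).some⟩
  funI f args := Quotient.mk _ fun n => (M n).funI f fun i => (args i).out n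
  predI p args := ∀ᶠ n in U, (M n).predI p fun i => (args i).out n

/-- The element of the ultraproduct given by a sequence of elements. -/
def ultraMk (U : Ultrafilter ℕ) (M : ℕ → Struct.{u, v} Sg) {σ : Sg.Srt}
    (a : ∀ n, (M n).carrier σ) : (ultraproduct U M).carrier σ :=
  Quotient.mk (ultraSetoid U M σ) a

/-- The valuation in the ultraproduct given by a sequence of valuations. -/
def ultraVal (U : Ultrafilter ℕ) (M : ℕ → Struct.{u, v} Sg) (val : ∀ n, (M n).Valuation) :
    (ultraproduct U M).Valuation :=
  fun x => ultraMk U M fun n => val n x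

variable (U : Ultrafilter ℕ) (M : ℕ → Struct.{u, v} Sg)

theorem exists_ultraMk_eq {σ : Sg.Srt} (a : (ultraproduct U M).carrier σ) :
    ∃ b, ultraMk U M b = a :=
  Quotient.exists_rep a

theorem exists_ultraVal_eq (w : (ultraproduct U M).Valuation) :
    ∃ val : ∀ n, (M n).Valuation, ultraVal U M val = w :=
  ⟨fun n x => Quotient.out (w x) n, funext fun x => Quotient.out_eq (w x)⟩

theorem ultraVal_update (val : ∀ n, (M n).Valuation) (x : Var Sg) (a : ∀ n, (M n).carrier x.1)
    [DecidableEq (Var Sg)] :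
    ultraVal U M (fun n => Function.update (val n) x (a n)) =
      Function.update (ultraVal U M val) x (ultraMk U M a) := by
  funext y
  rcases eq_or_ne y x with rfl | h
  · rw [Function.update_self]
    simp [ultraVal]
  · rw [Function.update_of_ne h]
    simp [ultraVal, h]

theorem Term.eval_ultraVal (val : ∀ n, (M n).Valuation) {σ : Sg.Srt} (t : Term Sg σ) :
    t.eval (ultraproduct U M) (ultraVal U M val) =
      ultraMk U M fun n => t.eval (M n) (val n) := by
  induction t with
  | var σ n => rfl
  | app f args ih =>
    refine Quotient.sound (s := ultraSetoid U M _) ?_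
    -- Chosen representatives agree with the given sequences only almost everywhere; as there are
    -- finitely many arguments, one set in `U` serves for all of them.
    have : ∀ᶠ n in U, ∀ i, Quotient.out ((args i).eval (ultraproduct U M) (ultraVal U M val)) n =
        (args i).eval (M n) (val n) := by
      rw [Filter.eventually_all]
      intro i
      rw [ih i]
      exact Quotient.mk_out (s := ultraSetoid U M _) _
    refine this.mono fun n hn => ?_
    simp only [Term.eval]
    congr 1
    exact funext hn

/-- Łoś's theorem. -/
theorem Formula.sat_ultraVal (φ : Formula Sg) : ∀ val : ∀ n, (M n).Valuation,
    φ.Sat (ultraproduct U M) (ultraVal U M val) ↔ ∀ᶠ n in U, φ.Sat (M n) (val n) := by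
  classical
  induction φ with
  | falsum => intro val; simp [Formula.Sat, U.neBot.ne]
  | eq s t =>
    intro val
    simp only [Formula.Sat, Term.eval_ultraVal]
    exact Quotient.eq (r := ultraSetoid U M _)
  | rel p args =>
    intro val
    refine Filter.eventually_congr ?_
    have : ∀ᶠ n in U, ∀ i, Quotient.out ((args i).eval (ultraproduct U M) (ultraVal U M val)) n =
        (args i).eval (M n) (val n) := by
      rw [Filter.eventually_all]
      intro i
      rw [(args i).eval_ultraVal]
      exact Quotient.mk_out (s := ultraSetoid U M _) _
    refine this.mono fun n hn => ?_
    simp only [Formula.Sat]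
    rw [funext hn]
  | neg φ ih =>
    intro val
    simp only [Formula.Sat, ih, Ultrafilter.eventually_not]
  | and φ ψ ih₁ ih₂ =>
    intro val
    simp only [Formula.Sat, ih₁, ih₂, Filter.eventually_and]
  | or φ ψ ih₁ ih₂ =>
    intro val
    simp only [Formula.Sat, ih₁, ih₂, Ultrafilter.eventually_or]
  | imp φ ψ ih₁ ih₂ =>
    intro val
    simp only [Formula.Sat, ih₁, ih₂, Ultrafilter.eventually_imp]
  | all x φ ih =>
    intro val
    simp only [Formula.Sat]
    constructor
    · intro h
      by_contra hc
      rw [← Ultrafilter.eventually_not] at hc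
      -- A counterexample is picked wherever there is one, and the arbitrary value `val n x`
      -- elsewhere, so that the choices form a sequence.
      have hc' : ∀ n, ∃ a, (¬ ∀ b, φ.Sat (M n) (Function.update (val n) x b)) →
          ¬ φ.Sat (M n) (Function.update (val n) x a) := fun n => by
        by_cases hn : ∀ b, φ.Sat (M n) (Function.update (val n) x b)
        · exact ⟨val n x, fun h' => absurd hn h'⟩
        · obtain ⟨b, hb⟩ := not_forall.1 hn
          exact ⟨b, fun _ => hb⟩
      choose a ha using hc'
      have h₁ := h (ultraMk U M a)
      rw [← ultraVal_update, ih] at h₁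
      obtain ⟨n, hn₁, hn₂⟩ := (h₁.and hc).exists
      exact ha n hn₂ hn₁
    · intro h a
      obtain ⟨a, rfl⟩ := exists_ultraMk_eq U M a
      rw [← ultraVal_update, ih]
      exact h.mono fun n hn => hn _
  | ex x φ ih =>
    intro val
    simp only [Formula.Sat]
    constructor
    · rintro ⟨a, ha⟩
      obtain ⟨a, rfl⟩ := exists_ultraMk_eq U M a
      rw [← ultraVal_update, ih] at ha
      exact ha.mono fun n hn => ⟨_, hn⟩
    · intro h
      have h' : ∀ n, ∃ a, (∃ b, φ.Sat (M n) (Function.update (val n) x b)) →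
          φ.Sat (M n) (Function.update (val n) x a) := fun n => by
        by_cases hn : ∃ b, φ.Sat (M n) (Function.update (val n) x b)
        · exact ⟨hn.choose, fun _ => hn.choose_spec⟩
        · exact ⟨val n x, fun h' => absurd h' hn⟩
      choose a ha using h'
      refine ⟨ultraMk U M a, ?_⟩
      rw [← ultraVal_update, ih]
      exact h.mono ha

theorem ultraproduct_mem_models {T : Theory Sg} (h : ∀ n, M n ∈ T.models) :
    ultraproduct U M ∈ T.models := by
  intro φ hφ w
  obtain ⟨val, rfl⟩ := exists_ultraVal_eq U M w
  exact (φ.sat_ultraVal U M val).2 (.of_forall fun n => h n φ hφ _)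

/-- Choosing `k` distinct elements in almost every factor gives `k` sequences, pairwise different
almost everywhere. -/
theorem natCast_le_mk_ultraproduct {σ : Sg.Srt} {k : ℕ}
    (h : ∀ᶠ n in U, (k : Cardinal) ≤ Cardinal.mk ((M n).carrier σ)) :
    (k : Cardinal) ≤ Cardinal.mk ((ultraproduct U M).carrier σ) := by
  have h' : ∀ n, ∃ e : Fin k → (M n).carrier σ,
      (k : Cardinal) ≤ Cardinal.mk ((M n).carrier σ) → Function.Injective e := fun n => by
    by_cases hn : (k : Cardinal) ≤ Cardinal.mk ((M n).carrier σ)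
    · have : Cardinal.lift.{u} (Cardinal.mk (Fin k)) ≤
          Cardinal.lift.{0} (Cardinal.mk ((M n).carrier σ)) := by simpa using hn
      obtain ⟨e⟩ := Cardinal.lift_mk_le'.1 this
      exact ⟨e, fun _ => e.injective⟩
    · exact ⟨fun _ => ((M n).nonempty σ).some, fun h => absurd h hn⟩
  choose e he using h'
  have hinj : Function.Injective (fun i : Fin k =>
      (ultraMk U M fun n => e n i)) := by
    intro i j hij
    have hij : ∀ᶠ n in U, e n i = e n j := Quotient.exact hij
    obtain ⟨n, hn₁, hn₂⟩ := (hij.and h).exists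
    exact he n hn₂ hn₁
  have := Cardinal.lift_mk_le_lift_mk_of_injective hinj
  rwa [Cardinal.mk_fin, Cardinal.lift_natCast, Cardinal.lift_uzero] at this

/-- Label the elements of almost every factor injectively by numbers below `k`. Along a sequence the
label takes finitely many values, so the ultrafilter selects one of them, and this limit label
determines the class of the sequence. -/
theorem mk_ultraproduct_le_natCast {σ : Sg.Srt} {k : ℕ}
    (h : ∀ᶠ n in U, Cardinal.mk ((M n).carrier σ) ≤ k) :
    Cardinal.mk ((ultraproduct U M).carrier σ) ≤ k := by
  have h' : ∀ n, ∃ e : (M n).carrier σ → ℕ,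
      Cardinal.mk ((M n).carrier σ) ≤ k → Function.Injective e ∧ ∀ a, e a < k := fun n => by
    by_cases hn : Cardinal.mk ((M n).carrier σ) ≤ k
    · have : Cardinal.lift.{0} (Cardinal.mk ((M n).carrier σ)) ≤
          Cardinal.lift.{u} (Cardinal.mk (Fin k)) := by simpa using hn
      obtain ⟨e⟩ := Cardinal.lift_mk_le'.1 this
      exact ⟨fun a => e a, fun _ => ⟨Fin.val_injective.comp e.injective, fun a => (e a).2⟩⟩
    · exact ⟨fun _ => 0, fun h => absurd h hn⟩
  choose e he using h'
  have key : ∀ a : (ultraproduct U M).carrier σ, ∃ i : Fin k,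
      ∀ᶠ n in U, e n (Quotient.out a n) = i := by
    intro a
    have : ∀ᶠ n in U, ∃ i : Fin k, e n (Quotient.out a n) = i :=
      h.mono fun n hn => ⟨⟨_, (he n hn).2 _⟩, rfl⟩
    rwa [Ultrafilter.eventually_exists_iff] at this
  choose g hg using key
  have hinj : Function.Injective g := by
    intro a b hab
    rw [← Quotient.out_eq a, ← Quotient.out_eq b]
    refine Quotient.sound (s := ultraSetoid U M σ) ?_
    have hb := hg b
    rw [← hab] at hb
    filter_upwards [hg a, hb, h] with n h₁ h₂ h₃
    exact (he n h₃).1 (h₁.trans h₂.symm)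
  have := Cardinal.lift_mk_le_lift_mk_of_injective hinj
  simpa using this

/-! ### The downward Löwenheim–Skolem theorem -/

/-- The elements of all the domains of a structure. -/
abbrev Struct.Elem (M : Struct.{u, v} Sg) : Type (max u v) := Σ σ, M.carrier σ

/-- The elements of a set of elements that have a given sort. -/
abbrev Struct.Fiber (M : Struct.{u, v} Sg) (X : Set M.Elem) (σ : Sg.Srt) : Type u :=
  {a : M.carrier σ // (⟨σ, a⟩ : M.Elem) ∈ X}

theorem Struct.countable_fiber (M : Struct.{u, v} Sg) {X : Set M.Elem} (hX : X.Countable)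
    (σ : Sg.Srt) : Countable (M.Fiber X σ) := by
  have : Countable X := hX.to_subtype
  refine Function.Injective.countable (f := fun a : M.Fiber X σ => (⟨⟨σ, a.1⟩, a.2⟩ : X)) ?_
  intro a b h
  simpa [Subtype.ext_iff] using h

/-- A valuation with prescribed values on the free variables of a formula. -/
noncomputable def Struct.extendVal (M : Struct.{u, v} Sg) (φ : Formula Sg)
    (g : ∀ x : φ.vars, M.carrier x.1.1) : M.Valuation :=
  open Classical in fun x => if h : x ∈ φ.vars then g ⟨x, h⟩ else (M.nonempty x.1).some

/-- A witness for `∃ y. φ`, if there is one. -/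
noncomputable def Struct.witness (M : Struct.{u, v} Sg) (φ : Formula Sg) (y : Var Sg)
    (val : M.Valuation) : M.carrier y.1 :=
  open Classical in
  if h : ∃ a, φ.Sat M (Function.update val y a) then h.choose else (M.nonempty y.1).some

/-- One step of closing a set of elements under functions and witnesses. -/
noncomputable def Struct.closureStep (M : Struct.{u, v} Sg) (X : Set M.Elem) : Set M.Elem :=
  X ∪ (Set.range fun p : Σ f : Sg.FunSym, ∀ i, M.Fiber X ((Sg.dom f).get i) =>
      (⟨Sg.cod p.1, M.funI p.1 fun i => (p.2 i).1⟩ : M.Elem)) ∪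
    Set.range fun p : Σ q : Formula Sg × Var Sg, ∀ x : q.1.vars, M.Fiber X x.1.1 =>
      (⟨p.1.2.1, M.witness p.1.1 p.1.2 (M.extendVal p.1.1 fun x => (p.2 x).1)⟩ : M.Elem)

theorem Struct.countable_closureStep (M : Struct.{u, v} Sg) {X : Set M.Elem} (hX : X.Countable) :
    (M.closureStep X).Countable := by
  have := Sg.countable_srt
  have := Sg.countable_funSym
  have := M.countable_fiber hX
  exact (hX.union (Set.countable_range _)).union (Set.countable_range _)

/-- The closure of a set of elements under functions and witnesses. -/
noncomputable def Struct.hull (M : Struct.{u, v} Sg) (X : Set M.Elem) : Set M.Elem :=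
  ⋃ n, M.closureStep^[n] X

theorem Struct.countable_hull (M : Struct.{u, v} Sg) {X : Set M.Elem} (hX : X.Countable) :
    (M.hull X).Countable := by
  refine Set.countable_iUnion fun n => ?_
  induction n with
  | zero => exact hX
  | succ n ih =>
    rw [Function.iterate_succ_apply']
    exact M.countable_closureStep ih

theorem Struct.subset_hull (M : Struct.{u, v} Sg) (X : Set M.Elem) : X ⊆ M.hull X :=
  Set.subset_iUnion (fun n => M.closureStep^[n] X) 0

theorem Struct.monotone_iterate_closureStep (M : Struct.{u, v} Sg) (X : Set M.Elem) :
    Monotone fun n => M.closureStep^[n] X := by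
  refine monotone_nat_of_le_succ fun n => ?_
  rw [Function.iterate_succ_apply']
  exact Set.subset_union_left.trans Set.subset_union_left

theorem Struct.exists_stage (M : Struct.{u, v} Sg) (X : Set M.Elem) {ι : Type*} [Fintype ι]
    (p : ι → M.Elem) (h : ∀ i, p i ∈ M.hull X) : ∃ n, ∀ i, p i ∈ M.closureStep^[n] X := by
  choose k hk using fun i => Set.mem_iUnion.1 (h i)
  exact ⟨Finset.univ.sup k, fun i =>
    M.monotone_iterate_closureStep X (Finset.le_sup (Finset.mem_univ i)) (hk i)⟩

theorem Struct.closureStep_iterate_subset_hull (M : Struct.{u, v} Sg) (X : Set M.Elem) (n : ℕ) :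
    M.closureStep (M.closureStep^[n] X) ⊆ M.hull X := by
  rw [← Function.iterate_succ_apply' M.closureStep]
  exact Set.subset_iUnion (fun n => M.closureStep^[n] X) (n + 1)

theorem Struct.funI_mem_hull (M : Struct.{u, v} Sg) (X : Set M.Elem) (f : Sg.FunSym)
    (args : ∀ i, M.Fiber (M.hull X) ((Sg.dom f).get i)) :
    (⟨Sg.cod f, M.funI f fun i => (args i).1⟩ : M.Elem) ∈ M.hull X := by
  obtain ⟨n, hn⟩ := M.exists_stage X (fun i => (⟨_, (args i).1⟩ : M.Elem)) fun i => (args i).2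
  exact M.closureStep_iterate_subset_hull X n
    (.inl (.inr ⟨⟨f, fun i => ⟨(args i).1, hn i⟩⟩, rfl⟩))

-- This is the Tarski–Vaught condition. A formula sees only the finitely many values of its free
-- variables; these all occur at one stage, and the next stage contains a witness.
open Classical in
theorem Struct.exists_witness_mem_hull (M : Struct.{u, v} Sg) (X : Set M.Elem) (φ : Formula Sg)
    (y : Var Sg) (val : M.Valuation) (hval : ∀ x, (⟨x.1, val x⟩ : M.Elem) ∈ M.hull X)
    (h : ∃ a, φ.Sat M (Function.update val y a)) :
    ∃ a, (⟨y.1, a⟩ : M.Elem) ∈ M.hull X ∧ φ.Sat M (Function.update val y a) := by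
  obtain ⟨n, hn⟩ := M.exists_stage X (fun x : φ.vars => (⟨x.1.1, val x.1⟩ : M.Elem))
    fun x => hval x.1
  have key : ∀ a, φ.Sat M (Function.update val y a) ↔
      φ.Sat M (Function.update (M.extendVal φ fun x => val x.1) y a) := fun a => by
    refine φ.sat_congr M fun x hx => ?_
    rcases eq_or_ne x y with rfl | hne
    · simp
    · simp [hne, Struct.extendVal, hx]
  refine ⟨M.witness φ y (M.extendVal φ fun x => val x.1),
    M.closureStep_iterate_subset_hull X n
      (.inr ⟨⟨(φ, y), fun x => ⟨val x.1, hn x⟩⟩, rfl⟩), ?_⟩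
  rw [key]
  have h' : ∃ a, φ.Sat M (Function.update (M.extendVal φ fun x => val x.1) y a) := by
    obtain ⟨a, ha⟩ := h
    exact ⟨a, (key a).1 ha⟩
  rw [Struct.witness, dif_pos h']
  exact h'.choose_spec

/-- The substructure on a hull. -/
def Struct.hullStruct (M : Struct.{u, v} Sg) (X : Set M.Elem)
    (hne : ∀ σ, Nonempty (M.Fiber (M.hull X) σ)) : Struct.{u, v} Sg where
  carrier := M.Fiber (M.hull X)
  nonempty := hne
  funI f args := ⟨M.funI f fun i => (args i).1, M.funI_mem_hull X f args⟩
  predI p args := M.predI p fun i => (args i).1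

section

variable (M : Struct.{u, v} Sg) (X : Set M.Elem) (hne : ∀ σ, Nonempty (M.Fiber (M.hull X) σ))

theorem Term.eval_hullStruct (val : (M.hullStruct X hne).Valuation) {σ : Sg.Srt} (t : Term Sg σ) :
    (t.eval (M.hullStruct X hne) val).1 = t.eval M fun x => (val x).1 := by
  induction t with
  | var σ n => rfl
  | app f args ih =>
    simp only [Term.eval]
    exact congrArg (M.funI f) (funext ih)

theorem Formula.sat_hullStruct (φ : Formula Sg) : ∀ val : (M.hullStruct X hne).Valuation,
    φ.Sat (M.hullStruct X hne) val ↔ φ.Sat M fun x => (val x).1 := by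
  classical
  have hupd : ∀ (val : (M.hullStruct X hne).Valuation) (x : Var Sg)
      (a : (M.hullStruct X hne).carrier x.1), (fun y => (Function.update val x a y).1) =
        Function.update (β := fun x => M.carrier x.1) (fun y => (val y).1) x a.1 := by
    intro val x a
    funext y
    rcases eq_or_ne y x with rfl | h
    · simp
    · simp [h]
  induction φ with
  | falsum => intro val; rfl
  | eq s t =>
    intro val
    simp only [Formula.Sat, ← Term.eval_hullStruct]
    exact Subtype.ext_iff
  | rel p args =>
    intro val
    simp only [Formula.Sat, ← Term.eval_hullStruct]
    rfl
  | neg φ ih => intro val; exact not_congr (ih val)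
  | and φ ψ ih₁ ih₂ => intro val; exact and_congr (ih₁ val) (ih₂ val)
  | or φ ψ ih₁ ih₂ => intro val; exact or_congr (ih₁ val) (ih₂ val)
  | imp φ ψ ih₁ ih₂ => intro val; exact imp_congr (ih₁ val) (ih₂ val)
  | all x φ ih =>
    intro val
    simp only [Formula.Sat, ih, hupd]
    constructor
    · intro h
      by_contra hc
      -- A counterexample to `φ` is a witness for its negation, so one already lies in the hull.
      obtain ⟨a, ha, hφ⟩ := M.exists_witness_mem_hull X φ.neg x _ (fun y => (val y).2)
        (not_forall.1 hc)
      exact hφ (h ⟨a, ha⟩)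
    · exact fun h a => h a.1
  | ex x φ ih =>
    intro val
    simp only [Formula.Sat, ih, hupd]
    constructor
    · exact fun ⟨a, ha⟩ => ⟨a.1, ha⟩
    · intro h
      obtain ⟨a, ha, hφ⟩ := M.exists_witness_mem_hull X φ x _ (fun y => (val y).2) h
      exact ⟨⟨a, ha⟩, hφ⟩

end

/-- The downward Löwenheim–Skolem theorem: every interpretation has an elementary subinterpretation
in which the countable domains are kept and the other ones become countably infinite. -/
theorem Interp.exists_countable_elementary (A : Interp.{u, v} Sg) :
    ∃ B : Interp.{u, v} Sg, (∀ T : Theory Sg, T.IsInterp A → T.IsInterp B) ∧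
      (∀ φ, B.Satisfies φ ↔ A.Satisfies φ) ∧
      ∀ σ, Cardinal.mk (B.carrier σ) = min (Cardinal.mk (A.carrier σ)) Cardinal.aleph0 := by
  have := Sg.countable_srt
  choose s hs using fun σ => Cardinal.le_mk_iff_exists_set.1
    (min_le_left (Cardinal.mk (A.carrier σ)) Cardinal.aleph0)
  -- The values of the variables let the valuation restrict to the hull and make every sort
  -- nonempty; the sets `s σ` give the lower bound on the cardinals.
  let X : Set A.toStruct.Elem :=
    (Set.range fun x : Var Sg => (⟨x.1, A.val x⟩ : A.toStruct.Elem)) ∪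
      ⋃ σ, (fun a => (⟨σ, a⟩ : A.toStruct.Elem)) '' s σ
  have hX : X.Countable := by
    refine (Set.countable_range _).union (Set.countable_iUnion fun σ => Set.Countable.image ?_ _)
    rw [← Cardinal.le_aleph0_iff_set_countable, hs]
    exact min_le_right _ _
  have hval : ∀ x, (⟨x.1, A.val x⟩ : A.toStruct.Elem) ∈ A.toStruct.hull X := fun x =>
    A.toStruct.subset_hull X (.inl ⟨x, rfl⟩)
  have hne : ∀ σ, Nonempty (A.toStruct.Fiber (A.toStruct.hull X) σ) := fun σ =>
    ⟨⟨A.val (σ, 0), hval (σ, 0)⟩⟩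
  refine ⟨⟨A.toStruct.hullStruct X hne, fun x => ⟨A.val x, hval x⟩⟩, fun T hT φ hφ val => ?_,
    fun φ => φ.sat_hullStruct A.toStruct X hne _, fun σ => le_antisymm (le_min ?_ ?_) ?_⟩
  · exact (φ.sat_hullStruct A.toStruct X hne val).2 (hT φ hφ _)
  · exact Cardinal.mk_subtype_le _
  · have := A.toStruct.countable_fiber (A.toStruct.countable_hull hX) σ
    exact Cardinal.mk_le_aleph0 (α := A.toStruct.Fiber (A.toStruct.hull X) σ)
  · rw [← hs]
    refine Cardinal.mk_le_mk_of_subset (s := s σ)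
      (t := {a | (⟨σ, a⟩ : A.toStruct.Elem) ∈ A.toStruct.hull X}) fun a ha => ?_
    exact A.toStruct.subset_hull X (.inr (Set.mem_iUnion.2 ⟨σ, a, ha, rfl⟩))

/-! ### Models with prescribed finite domains -/

/-- On `s` the map `g` factors through `f`, so one preimage for each value of `f` suffices to reach
every value of `g`. -/
theorem ncard_image_le_of_imp {α β γ : Type*} {s : Set α} (hs : s.Finite) {f : α → β} {g : α → γ}
    (h : ∀ x ∈ s, ∀ y ∈ s, f x = f y → g x = g y) : (g '' s).ncard ≤ (f '' s).ncard := by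
  choose r hrs hr using fun b : f '' s => b.2
  have : Finite (f '' s) := (hs.image f).to_subtype
  have hsub : g '' s ⊆ Set.range fun b => g (r b) := by
    rintro _ ⟨x, hx, rfl⟩
    exact ⟨⟨f x, x, hx, rfl⟩, h _ (hrs _) _ hx (hr _)⟩
  calc (g '' s).ncard ≤ (Set.range fun b => g (r b)).ncard :=
        Set.ncard_le_ncard hsub (Set.finite_range _)
    _ ≤ Nat.card (f '' s) := by
        rw [← Set.image_univ, ← Set.ncard_univ]
        exact Set.ncard_image_le
    _ = (f '' s).ncard := rfl

theorem ncard_image_eq_of_iff {α β γ : Type*} {s : Set α} (hs : s.Finite) {f : α → β} {g : α → γ}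
    (h : ∀ x ∈ s, ∀ y ∈ s, f x = f y ↔ g x = g y) : (g '' s).ncard = (f '' s).ncard :=
  le_antisymm (ncard_image_le_of_imp hs fun x hx y hy => (h x hx y hy).1)
    (ncard_image_le_of_imp hs fun x hx y hy => (h x hx y hy).2)

/-- The indices of the variables of sort `σ` in `V`. -/
def indices (V : Finset (Var Sg)) (σ : Sg.Srt) : Set ℕ := {n | (σ, n) ∈ V}

theorem finite_indices (V : Finset (Var Sg)) (σ : Sg.Srt) : (indices V σ).Finite :=
  V.finite_toSet.preimage (Prod.mk_right_injective σ).injOn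

theorem ncard_indices_le (V : Finset (Var Sg)) (σ : Sg.Srt) : (indices V σ).ncard ≤ V.card := by
  rw [← Set.ncard_coe_finset]
  exact Set.ncard_le_ncard_of_injOn (fun n => (σ, n)) (fun _ h => h)
    (Prod.mk_right_injective σ).injOn V.finite_toSet

/-- The values of the variables of sort `σ` in `V`. -/
abbrev Struct.values (M : Struct.{u, v} Sg) (val : M.Valuation) (V : Finset (Var Sg))
    (σ : Sg.Srt) : Set (M.carrier σ) := (fun n => val (σ, n)) '' indices V σ

theorem ncard_values_eq_of_sat {M N : Struct.{u, v} Sg} {val : M.Valuation} {val' : N.Valuation}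
    {V : Finset (Var Sg)} (h : (arrangement V (valKer val)).Sat N val') (σ : Sg.Srt) :
    (N.values val' V σ).ncard = (M.values val V σ).ncard :=
  ncard_image_eq_of_iff (finite_indices V σ) fun m hm n hn => (sat_arrangement N val' V _).1 h
    σ m n hm hn

/-- In a structure with infinite domains, fresh variables can be used to obtain any sufficiently
large finite numbers of values. -/
theorem Struct.exists_values_ncard (M : Struct.{u, v} Sg) (val : M.Valuation)
    (W V₀ : Finset (Var Sg)) (hV₀ : V₀ ⊆ W) (F : Finset Sg.Srt)
    (hF : ∀ σ ∈ F, Infinite (M.carrier σ)) (N : Sg.Srt → ℕ)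
    (hN : ∀ σ ∈ F, (M.values val V₀ σ).ncard ≤ N σ) :
    ∃ (val' : M.Valuation) (V : Finset (Var Sg)), V₀ ⊆ V ∧ (∀ x ∈ V, x ∈ V₀ ∨ x.1 ∈ F) ∧
      (∀ x ∈ W, val' x = val x) ∧ ∀ σ ∈ F, (M.values val' V σ).ncard = N σ := by
  classical
  -- Variables with index at least `b` do not occur in `W`, so they may be revalued freely.
  obtain ⟨b, hb⟩ : ∃ b, ∀ x ∈ W, x.2 < b :=
    ⟨W.sup (fun x => x.2) + 1, fun x hx => Nat.lt_succ_of_le (Finset.le_sup (f := fun x => x.2) hx)⟩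
  have hfin : ∀ σ, (M.values val V₀ σ).Finite := fun σ => (finite_indices V₀ σ).image _
  have he : ∀ σ, ∃ e : ℕ → M.carrier σ, σ ∈ F →
      Function.Injective e ∧ ∀ i, e i ∉ M.values val V₀ σ := by
    intro σ
    by_cases hσ : σ ∈ F
    · have := hF σ hσ
      have := (hfin σ).infinite_compl.to_subtype
      exact ⟨fun i => (Infinite.natEmbedding ((M.values val V₀ σ)ᶜ : Set _) i).1, fun _ =>
        ⟨Subtype.val_injective.comp (Infinite.natEmbedding _).injective, fun i =>
          (Infinite.natEmbedding ((M.values val V₀ σ)ᶜ : Set _) i).2⟩⟩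
    · exact ⟨fun _ => (M.nonempty σ).some, fun h => absurd h hσ⟩
  choose e he using he
  -- The number of values still missing; the variables `(σ, b + i)` with `i < d σ` will name that
  -- many new elements.
  let d : Sg.Srt → ℕ := fun σ => N σ - (M.values val V₀ σ).ncard
  let val' : M.Valuation := fun x => if x.2 < b then val x else e x.1 (x.2 - b)
  let V : Finset (Var Sg) := V₀ ∪ F.biUnion fun σ => (Finset.range (d σ)).image fun i => (σ, b + i)
  have hval' : ∀ x ∈ W, val' x = val x := fun x hx => if_pos (hb x hx)
  refine ⟨val', V, Finset.subset_union_left, fun x hx => ?_, hval', fun σ hσ => ?_⟩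
  · rcases Finset.mem_union.1 hx with hx | hx
    · exact .inl hx
    · simp only [Finset.mem_biUnion, Finset.mem_image] at hx
      obtain ⟨σ, hσ, i, -, rfl⟩ := hx
      exact .inr hσ
  · have hvalues : M.values val' V σ = M.values val V₀ σ ∪ e σ '' (Finset.range (d σ) : Set ℕ) := by
      ext a
      constructor
      · rintro ⟨n, hn, rfl⟩
        rcases Finset.mem_union.1 hn with hx | hx
        · exact .inl ⟨n, hx, (hval' _ (hV₀ hx)).symm⟩
        · simp only [Finset.mem_biUnion, Finset.mem_image, Prod.mk.injEq] at hx
          obtain ⟨τ, hτ, i, hi, rfl, rfl⟩ := hx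
          exact .inr ⟨i, hi, by simp [val']⟩
      · rintro (⟨n, hn, rfl⟩ | ⟨i, hi, rfl⟩)
        · exact ⟨n, Finset.mem_union_left _ hn, hval' _ (hV₀ hn)⟩
        · refine ⟨b + i, Finset.mem_union_right _ ?_, by simp [val']⟩
          simp only [Finset.mem_biUnion, Finset.mem_image]
          exact ⟨σ, hσ, i, hi, rfl⟩
    rw [hvalues, Set.ncard_union_eq ?_ (hfin σ) ((Finset.finite_toSet _).image _),
      Set.ncard_image_of_injective _ (he σ hσ).1, Set.ncard_coe_finset, Finset.card_range]
    · have := hN σ hσ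
      simp only [d]
      omega
    · rw [Set.disjoint_right]
      rintro _ ⟨i, -, rfl⟩
      exact (he σ hσ).2 i

/-- The alternative in `hN` reflects the two bounds on the number of values of variables of `wit φ`:
the size of the domain in `A`, and the number of variables. The second one allows domains that are
infinite in `A`. -/
theorem IsStrongWitness.exists_interp_mk_eq {S : Set Sg.Srt} {T : Theory Sg}
    (hSI : Theory.StablyInfinite.{u, v} T S) {wit : QFFormula Sg → QFFormula Sg}
    (hwit : IsStrongWitness.{u, v} T S wit) (φ : QFFormula Sg) (A : Interp.{u, v} Sg)
    (hA : T.IsInterp A) (hAφ : A.Satisfies φ.1) (F : Finset Sg.Srt) (hF : ∀ σ ∈ F, σ ∈ S)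
    (N : Sg.Srt → ℕ)
    (hN : ∀ σ ∈ F, Cardinal.mk (A.carrier σ) ≤ N σ ∨ (wit φ).1.vars.card ≤ N σ) :
    ∃ B : Interp.{u, v} Sg, T.IsInterp B ∧ B.Satisfies φ.1 ∧
      ∀ σ ∈ F, Cardinal.mk (B.carrier σ) = N σ := by
  classical
  set ψ := (wit φ).1
  obtain ⟨val₀, hval₀⟩ :=
    Formula.exists_sat_of_sat_exs A.toStruct _ ((hwit.equivalent φ A hA).1 hAφ)
  let V₀ : Finset (Var Sg) := ψ.vars.filter fun x => x.1 ∈ S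
  have hV₀ : V₀ ⊆ ψ.vars := Finset.filter_subset _ _
  -- Including the arrangement keeps the infinite model from separating variables that are equal
  -- under `val₀`, which could push the number of values above `N σ`.
  obtain ⟨A₁, hA₁, ⟨hA₁ψ, hA₁E⟩, hinf⟩ := hSI
    ⟨ψ.and (arrangement V₀ (valKer val₀)), (wit φ).2, isQF_arrangement _ _⟩
    ⟨⟨A.toStruct, val₀⟩, hA, hval₀, sat_arrangement_ker _ _ _⟩
  have hcard : ∀ σ ∈ F, (A₁.values A₁.val V₀ σ).ncard ≤ N σ := by
    intro σ hσ
    rw [ncard_values_eq_of_sat hA₁E σ]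
    rcases hN σ hσ with h | h
    · have : Finite (A.carrier σ) := Cardinal.lt_aleph0_iff_finite.1
        (h.trans_lt Cardinal.natCast_lt_aleph0)
      refine (Set.ncard_le_ncard (Set.subset_univ _)).trans ?_
      rw [Set.ncard_univ]
      exact_mod_cast (Nat.cast_card (α := A.carrier σ)).trans_le h
    · exact (Set.ncard_image_le (finite_indices V₀ σ)).trans
        ((ncard_indices_le V₀ σ).trans ((Finset.card_le_card hV₀).trans h))
  obtain ⟨val₁, V, hV₀V, hVF, hval₁, hncard⟩ := A₁.exists_values_ncard A₁.val ψ.vars V₀ hV₀ F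
    (fun σ hσ => hinf σ (hF σ hσ)) N hcard
  obtain ⟨B, hB, ⟨hBψ, hBE⟩, hBV⟩ := hwit.finite_witness φ V (valKer val₁)
    (fun x hx => (hVF x hx).elim (fun h => (Finset.mem_filter.1 h).2) (hF _))
    ⟨⟨A₁.toStruct, val₁⟩, hA₁, (ψ.sat_congr _ hval₁).2 hA₁ψ, sat_arrangement_ker _ _ _⟩
  refine ⟨B, hB, (hwit.equivalent φ B hB).2 (Formula.sat_exs_of_sat _ _ hBψ), fun σ hσ => ?_⟩
  -- The variables of `wit φ` with sort in `S` already lie in `V`, so the values of `V` alone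
  -- exhaust the domain.
  have huniv : B.values B.val V σ = Set.univ := by
    refine Set.eq_univ_of_forall fun a => ?_
    obtain ⟨n, ⟨hn, -⟩, rfl⟩ := hBV σ (hF σ hσ) a
    refine ⟨n, ?_, rfl⟩
    rcases Finset.mem_union.1 hn with h | h
    · exact hV₀V (Finset.mem_filter.2 ⟨h, hF σ hσ⟩)
    · exact vars_arrangement_subset _ _ h
  have hfin : (B.values B.val V σ).Finite := (finite_indices V σ).image _
  rw [huniv, Set.finite_univ_iff] at hfin
  rw [← Nat.cast_card, ← Set.ncard_univ, ← huniv, ncard_values_eq_of_sat hBE σ, hncard σ hσ]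

/-- Compactness: the finite cardinalities prescribed in `exists_interp_mk_eq` can be realized for all
sorts of `S` at once, the remaining sorts of `S` getting countably infinite domains. -/
theorem IsStrongWitness.exists_interp_mk_eq_of_le_aleph0 {S : Set Sg.Srt} {T : Theory Sg}
    (hSI : Theory.StablyInfinite.{u, v} T S) {wit : QFFormula Sg → QFFormula Sg}
    (hwit : IsStrongWitness.{u, v} T S wit) (φ : QFFormula Sg) (A : Interp.{u, v} Sg)
    (hA : T.IsInterp A) (hAφ : A.Satisfies φ.1) (κ : Sg.Srt → Cardinal.{u})
    (hκ : ∀ σ ∈ S, κ σ = Cardinal.aleph0 ∨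
      ∃ k : ℕ, κ σ = k ∧ Cardinal.mk (A.carrier σ) ≤ k) :
    ∃ B : Interp.{u, v} Sg, T.IsInterp B ∧ B.Satisfies φ.1 ∧
      ∀ σ ∈ S, Cardinal.mk (B.carrier σ) = κ σ := by
  classical
  obtain ⟨c, hc⟩ := Sg.countable_srt.exists_injective_nat
  -- Where `ω` is wanted, `n` makes the sizes unbounded, and the maximum with the number of
  -- variables makes every stage admissible even if the domain in `A` is infinite.
  let N : ℕ → Sg.Srt → ℕ := fun n σ =>
    if κ σ = Cardinal.aleph0 then max n (wit φ).1.vars.card else (κ σ).toNat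
  have hF : ∀ n, {σ | σ ∈ S ∧ c σ < n}.Finite := fun n =>
    ((Set.finite_lt_nat n).preimage hc.injOn).subset fun σ h => h.2
  have hstep : ∀ n, ∃ B : Interp.{u, v} Sg, T.IsInterp B ∧ B.Satisfies φ.1 ∧
      ∀ σ ∈ (hF n).toFinset, Cardinal.mk (B.carrier σ) = N n σ := by
    intro n
    refine hwit.exists_interp_mk_eq hSI φ A hA hAφ _
      (fun σ hσ => ((hF n).mem_toFinset.1 hσ).1) (N n) fun σ hσ => ?_
    rcases hκ σ ((hF n).mem_toFinset.1 hσ).1 with h | ⟨k, hk, hle⟩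
    · simp [N, h]
    · simp [N, hk, hle, Cardinal.natCast_lt_aleph0.ne]
  choose B hB hBφ hBN using hstep
  let U : Ultrafilter ℕ := Filter.hyperfilter ℕ
  let M : ℕ → Struct.{u, v} Sg := fun n => (B n).toStruct
  have hlarge : ∀ m : ℕ, ∀ᶠ n in U, m < n := fun m =>
    (Filter.eventually_gt_atTop m).filter_mono Nat.hyperfilter_le_atTop
  -- The ultraproduct may have uncountable domains, hence the passage to an elementary
  -- subinterpretation.
  obtain ⟨D, hDT, hDφ, hDcard⟩ := Interp.exists_countable_elementary
    ⟨ultraproduct U M, ultraVal U M fun n => (B n).val⟩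
  refine ⟨D, hDT T (ultraproduct_mem_models U M hB),
    (hDφ φ.1).2 ((φ.1.sat_ultraVal U M _).2 (.of_forall hBφ)), fun σ hσ => ?_⟩
  rw [hDcard]
  have hcard : ∀ᶠ n in U, Cardinal.mk ((M n).carrier σ) = N n σ :=
    (hlarge (c σ)).mono fun n hn => hBN n σ ((hF n).mem_toFinset.2 ⟨hσ, hn⟩)
  rcases hκ σ hσ with h | ⟨k, hk, -⟩
  · rw [h, min_eq_right]
    refine Cardinal.aleph0_le.2 fun m => natCast_le_mk_ultraproduct U M ?_
    filter_upwards [hcard, hlarge m] with n hn hm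
    rw [hn]
    simp only [N, h, if_true]
    exact_mod_cast hm.le.trans (le_max_left _ _)
  · have hcard' : ∀ᶠ n in U, Cardinal.mk ((M n).carrier σ) = k :=
      hcard.mono fun n hn => by simpa [N, hk, Cardinal.natCast_lt_aleph0.ne] using hn
    rw [hk, le_antisymm (mk_ultraproduct_le_natCast U M (hcard'.mono fun n hn => hn.le))
      (natCast_le_mk_ultraproduct U M (hcard'.mono fun n hn => hn.ge)), min_eq_left]
    exact Cardinal.natCast_lt_aleph0.le

end ManySorted

theorem mainTheorem12 {Sg : ManySorted.Signature.{v}} (S : Set Sg.Srt) (T : ManySorted.Theory Sg)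
    (hSI : ManySorted.Theory.StablyInfinite.{u, v} T S)
    (hSFW : ManySorted.Theory.StronglyFinitelyWitnessable.{u, v} T S)
    (φ : ManySorted.QFFormula Sg)
    (A : ManySorted.Interp.{u, v} Sg) (hA : T.IsInterp A) (hAφ : A.Satisfies φ.1)
    (κ : ManySorted.countableSorts S A → Cardinal.{u})
    (hκ : ∀ σ : ManySorted.countableSorts S A,
      Cardinal.mk (A.carrier σ.1) ≤ κ σ ∧ κ σ ≤ Cardinal.aleph0) :
    ∃ B : ManySorted.Interp.{u, v} Sg, T.IsInterp B ∧ B.Satisfies φ.1 ∧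
      (∀ σ : ManySorted.countableSorts S A, Cardinal.mk (B.carrier σ.1) = κ σ) ∧
      (∀ σ ∈ S \ ManySorted.countableSorts S A,
        Cardinal.mk (B.carrier σ) = Cardinal.aleph0) := by
  classical
  obtain ⟨wit, hwit⟩ := hSFW
  -- Extending `κ` by `ω` on the sorts with uncountable domain reduces both cardinality claims to
  -- one.
  obtain ⟨B, hB, hBφ, hBκ⟩ := hwit.exists_interp_mk_eq_of_le_aleph0 hSI φ A hA hAφ
    (fun σ => if h : σ ∈ ManySorted.countableSorts S A then κ ⟨σ, h⟩ else Cardinal.aleph0)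
    fun σ _ => by
      by_cases h : σ ∈ ManySorted.countableSorts S A
      · obtain ⟨h₁, h₂⟩ := hκ ⟨σ, h⟩
        simp only [dif_pos h]
        rcases h₂.eq_or_lt with h₂ | h₂
        · exact .inl h₂
        · obtain ⟨k, hk⟩ := Cardinal.lt_aleph0.1 h₂
          exact .inr ⟨k, hk, hk ▸ h₁⟩
      · exact .inl (dif_neg h)
  exact ⟨B, hB, hBφ, fun σ => (hBκ σ.1 σ.2.1).trans (dif_pos σ.2),
    fun σ hσ => (hBκ σ hσ.1).trans (dif_neg hσ.2)⟩
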